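/- Let $G$ be a finitely generated torsion-free nilpotent group of nilpotency class exactly $c$, let $p,q$ be (not necessarily distinct) primes, let $H\le G$ be a subgroup of index $pq$, and let $f:H\to G$, $h\mapsto h^f$, be a homomorphism. For a homomorphism $\varphi:B\to A$ from a subgroup $B$ of a group $A$, the $\varphi$-core of $B$ is the largest subgroup $K\le B$ that is normal in $A$ and satisfies $K^{\varphi}\le K$. Assume that $f$ is simple, i.e. the $f$-core of $H$ is trivial. Write $Z_i(G)$ and $\gamma_i(G)$ for the terms of the upper and lower central series of $G$, with $Z_0(G)=1$, $Z(G)=Z_1(G)$ and $\gamma_1(G)=G$. Then $(H\cap Z(G))^f\le Z(G)$, so that $f$ induces a homomorphism $\overline f: HZ(G)/Z(G)\to G/Z(G)$, $hZ(G)\mapsto h^fZ(G)$. Let $L\le G$ be the (normal) subgroup containing $Z(G)$ such that $L/Z(G)$ is the $\overline f$-core of $HZ(G)/Z(G)$. Then: (i) $L$ and $G/L$ are free abelian groups; (ii) if $G$ is non-abelian, then $G=H\cdot H^f=\{hk : h\in H,\ k\in H^f\}$; (iii) $Z_{c-1}(G)\le L$; (iv) $Z(G)$ is the isolator of $\gamma_c(G)$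 in $G$, i.e. $Z(G)=\{x\in G : x^n\in\gamma_c(G)\text{ for some integer } n\ge 1\}$. -/

import Mathlib

open scoped Pointwise

namespace VirtualEndo

variable {G : Type*} [Group G] {H : Subgroup G}

/-- The subgroups of `H` that are normal in `G` and invariant under the virtual
endomorphism `f : H → G`. -/
def invariantNormal (f : H →* G) : Set (Subgroup G) :=
  {K | K ≤ H ∧ K.Normal ∧ ∀ x : H, (x : G) ∈ K → f x ∈ K}

/-- The `f`-core of `H`: the largest subgroup of `H` that is normal in `G` and `f`-invariant. -/
def core (f : H →* G) : Subgroup G := sSup (invariantNormal f)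

theorem core_isGreatest (f : H →* G) : IsGreatest (invariantNormal f) (core f) := by
  refine ⟨⟨sSup_le fun K hK => hK.1, ?_, ?_⟩, fun K hK => le_sSup hK⟩
  · rw [core, sSup_eq_iSup']
    have : ∀ K : invariantNormal f, (K : Subgroup G).Normal := fun K => K.2.2.1
    exact Subgroup.iSup_normal _
  · have key : core f ≤ ((core f).comap f).map H.subtype := by
      refine sSup_le fun K hK x hx => ?_
      exact ⟨⟨x, hK.1 hx⟩, (le_sSup hK : K ≤ core f) (hK.2.2 ⟨x, hK.1 hx⟩ hx), rfl⟩
    intro x hx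
    obtain ⟨y, hy, hyx⟩ := key hx
    have : y = x := Subtype.ext hyx
    exact this ▸ hy

instance core_normal (f : H →* G) : (core f).Normal := (core_isGreatest f).1.2.1

/-- The virtual endomorphism `f` is simple when its core is trivial. -/
def IsSimple (f : H →* G) : Prop := core f = ⊥

/-- For a normal subgroup `N` of `G` with `f (H ∩ N) ≤ N`, the virtual endomorphism
`HN/N → G/N`, `hN ↦ f(h)N`. Its domain `HN/N` is the image of `H` in `G/N`. -/
noncomputable def induced (f : H →* G) (N : Subgroup G) [N.Normal]
    (hN : ∀ x : H, (x : G) ∈ N → f x ∈ N) :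
    H.map (QuotientGroup.mk' N) →* G ⧸ N :=
  MonoidHom.liftOfSurjective ((QuotientGroup.mk' N).subgroupMap H)
    ((QuotientGroup.mk' N).subgroupMap_surjective H)
    ⟨(QuotientGroup.mk' N).comp f, by
      intro x hx
      have h1 : QuotientGroup.mk' N (x : G) = 1 := congrArg Subtype.val (MonoidHom.mem_ker.1 hx)
      have h2 : (x : G) ∈ N := (QuotientGroup.eq_one_iff _).1 h1
      exact MonoidHom.mem_ker.2 ((QuotientGroup.eq_one_iff _).2 (hN x h2))⟩

theorem induced_apply (f : H →* G) (N : Subgroup G) [N.Normal]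
    (hN : ∀ x : H, (x : G) ∈ N → f x ∈ N) (h : H) :
    induced f N hN ⟨QuotientGroup.mk' N h, Subgroup.mem_map_of_mem _ h.2⟩
      = QuotientGroup.mk' N (f h) :=
  MonoidHom.liftOfRightInverse_comp_apply ((QuotientGroup.mk' N).subgroupMap H) _ _ _ h

/-- The subgroup `L` of `G` containing `N` such that `L/N` is the core of the induced virtual
endomorphism `HN/N → G/N`. -/
noncomputable def inducedCore (f : H →* G) (N : Subgroup G) [N.Normal]
    (hN : ∀ x : H, (x : G) ∈ N → f x ∈ N) : Subgroup G :=
  (core (induced f N hN)).comap (QuotientGroup.mk' N)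

instance inducedCore_normal (f : H →* G) (N : Subgroup G) [N.Normal]
    (hN : ∀ x : H, (x : G) ∈ N → f x ∈ N) : (inducedCore f N hN).Normal :=
  Subgroup.Normal.comap (core_normal _) _

/-- The isolator of `K` in `G`: the elements having a positive power in `K`. -/
def isolator (K : Subgroup G) : Set G := {x | ∃ n : ℕ, 0 < n ∧ x ^ n ∈ K}

end VirtualEndo

/-- A (multiplicatively written) group is free abelian when it is isomorphic to the free abelian
group on some set. -/
def IsFreeAbelian (A : Type*) [Group A] : Prop :=
  ∃ S : Set A, Nonempty (A ≃* Multiplicative (FreeAbelianGroup S))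

/-! Let Z = Z(G). An invariant subgroup is one that f maps into itself where defined; simplicity
kills every normal invariant subgroup of H.

In a torsion-free nilpotent group each G/Z_i is torsion-free, so whatever centralizes a subgroup of
finite index modulo Z_i is central modulo Z_i. It follows that f is injective; a rank argument then
gives f(H) finite index, and hence every Z_i is invariant (`IsSimple.map_mem_upperCentralSeries`).

If G is non-abelian, Z is not contained in H, as it would lie in the core; and HZ ≠ G, since
otherwise γ_2(G) = γ_2(H) would be invariant. So [Z : H ∩ Z] and [G : HZ], whose product is pq, are
both prime: no subgroup lies strictly between H ∩ Z and Z, or between HZ and G. Each claim follows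
by showing that a failure forces a nontrivial normal invariant subgroup of H.

(i) [L, L] = [L ∩ H, L ∩ H] is invariant, so L is abelian. Its isolator I is abelian, normal and
invariant; either I ≤ HZ, whence I = L, or HI = G, which `exists_invariant_of_mul_eq` excludes. So
G/L is torsion-free with a simple endomorphism of prime index, hence abelian. (ii) HZ·f(H) = G and Z
= (H ∩ Z)·f(H ∩ Z), by primality. (iii) If HZ_{c-1} = G, then γ_c(G) = γ_c(H) would be invariant.
(iv) The isolator J of γ_c(G) is invariant, so Z = (H ∩ Z)J; if J ≠ Z, `exists_invariant_of_mul_eq`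
applies inside Z. -/

open scoped commutatorElement

namespace Subgroup

/-! ### Commutator calculus and central series; `lowerCentralSeries _ j` is γ_{j+1}. -/

section Commutators

variable {G : Type*} [Group G]

theorem commutatorElement_pow_pow_of_mem_center {a b : G} (h : ⁅a, b⁆ ∈ center G) (n m : ℕ) :
    ⁅a ^ n, b ^ m⁆ = ⁅a, b⁆ ^ (n * m) := by
  have hl : ∀ {a b : G}, ⁅a, b⁆ ∈ center G → ∀ n : ℕ, ⁅a ^ n, b⁆ = ⁅a, b⁆ ^ n := by
    intro a b h n
    induction n with
    | zero => simp
    | succ n ih =>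
      rw [pow_succ', commutatorElement_mul_left_eq_conj_mul, ih,
        mem_center_iff.1 (pow_mem h n) a, mul_inv_cancel_right, pow_succ]
  have hr : ∀ {a b : G}, ⁅a, b⁆ ∈ center G → ∀ n : ℕ, ⁅a, b ^ n⁆ = ⁅a, b⁆ ^ n := by
    intro a b h n
    rw [← commutatorElement_inv, hl (by rw [← commutatorElement_inv]; exact inv_mem h),
      ← commutatorElement_inv, inv_pow, inv_inv]
  rw [hr (by rw [hl h]; exact pow_mem h n), hl h, pow_mul]

theorem mk_mem_center_iff {i : ℕ} {x : G} :
    (QuotientGroup.mk x : G ⧸ upperCentralSeries G i) ∈ center (G ⧸ upperCentralSeries G i) ↔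
      x ∈ upperCentralSeries G (i + 1) := by
  have := SetLike.ext_iff.1 (upperCentralSeriesStep_eq_comap_center (upperCentralSeries G i)) x
  exact this.symm

theorem mk_commutatorElement (N : Subgroup G) [N.Normal] (x y : G) :
    (QuotientGroup.mk ⁅x, y⁆ : G ⧸ N) = ⁅(QuotientGroup.mk x : G ⧸ N), QuotientGroup.mk y⁆ := rfl

theorem commutatorElement_pow_pow_mem_iff {i : ℕ} {x y : G}
    (h : ⁅x, y⁆ ∈ upperCentralSeries G (i + 1)) (n m : ℕ) :
    ⁅x ^ n, y ^ m⁆ ∈ upperCentralSeries G i ↔ ⁅x, y⁆ ^ (n * m) ∈ upperCentralSeries G i := by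
  rw [← QuotientGroup.eq_one_iff, ← QuotientGroup.eq_one_iff, mk_commutatorElement]
  rw [← mk_mem_center_iff, mk_commutatorElement] at h
  rw [QuotientGroup.mk_pow, QuotientGroup.mk_pow, QuotientGroup.mk_pow,
    commutatorElement_pow_pow_of_mem_center h, mk_commutatorElement]

/-- The three subgroups lemma modulo a normal subgroup. -/
theorem commutator_commutator_le_of_rotate {N H₁ H₂ H₃ : Subgroup G} [N.Normal]
    (h1 : ⁅⁅H₂, H₃⁆, H₁⁆ ≤ N) (h2 : ⁅⁅H₃, H₁⁆, H₂⁆ ≤ N) : ⁅⁅H₁, H₂⁆, H₃⁆ ≤ N := by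
  have key : ∀ K : Subgroup G, K ≤ N ↔ K.map (QuotientGroup.mk' N) = ⊥ := fun K => by
    rw [Subgroup.map_eq_bot_iff, QuotientGroup.ker_mk']
  rw [key, map_commutator, map_commutator] at *
  exact commutator_commutator_eq_bot_of_rotate h1 h2

/-- Induction on j through the three subgroups lemma; each bracket with G lowers the upper central
index by one. -/
theorem commutator_upperCentralSeries_lowerCentralSeries_le (j k : ℕ) :
    ⁅lowerCentralSeries (⊤ : Subgroup G) j, upperCentralSeries G (k + j + 1)⁆ ≤
      upperCentralSeries G k := by
  induction j generalizing k with
  | zero =>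
    rw [commutator_comm]
    exact commutator_upperCentralSeries_top_le G k
  | succ j ih =>
    rw [lowerCentralSeries_succ]
    refine commutator_commutator_le_of_rotate ?_ ?_
    · rw [commutator_comm _ (lowerCentralSeries _ j), commutator_comm ⊤]
      exact (commutator_mono le_rfl (commutator_upperCentralSeries_top_le G _)).trans (ih k)
    · rw [commutator_comm (upperCentralSeries G _)]
      refine (commutator_mono (?_ : _ ≤ upperCentralSeries G (k + 1)) le_rfl).trans
        (commutator_upperCentralSeries_top_le G k)
      have := ih (k + 1)
      rwa [show k + 1 + j + 1 = k + (j + 1) + 1 by ring] at this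

theorem lowerCentralSeries_le_upperCentralSeries {i j n : ℕ} (hn : upperCentralSeries G n = ⊤)
    (hij : i + j = n) : lowerCentralSeries (⊤ : Subgroup G) j ≤ upperCentralSeries G i := by
  induction j generalizing i with
  | zero => subst hij; exact hn.ge
  | succ j ih =>
    exact (commutator_mono (ih (i := i + 1) (by omega)) le_rfl).trans
      (commutator_upperCentralSeries_top_le G i)

theorem commutatorElement_mul_mul_of_commute {a z h k : G} (hz : z ∈ center G)
    (hk : Commute a k) : ⁅a * z, h * k⁆ = ⁅a, h⁆ := by
  have h1 : ⁅z, h * k⁆ = 1 :=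
    commutatorElement_eq_one_iff_mul_comm.2 (mem_center_iff.1 hz _).symm
  rw [commutatorElement_mul_left_eq_conj_mul, h1, mul_one, mul_inv_cancel, one_mul,
    commutatorElement_mul_right_eq_mul_conj, hk.commutator_eq, mul_one, mul_inv_cancel_right]

/-- Used at i = 0 in two cases: m = 1 when H·Z_c = G, giving γ_{c+1}(G) ≤ γ_{c+1}(H), and k = 1 when
every m-th power lies in H, giving the same up to powers. -/
theorem pow_mem_lowerCentralSeries_sup {c m : ℕ} (hc : upperCentralSeries G (c + 1) = ⊤)
    {H : Subgroup G} (hm : ∀ g : G, ∃ h ∈ H, ∃ k ∈ upperCentralSeries G c, h * k = g ^ m)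
    {i j : ℕ} (hij : i + j = c) {x : G} (hx : x ∈ lowerCentralSeries (⊤ : Subgroup G) j) :
    x ^ m ^ (j + 1) ∈ lowerCentralSeries H j ⊔ upperCentralSeries G i := by
  induction j generalizing i x with
  | zero =>
    obtain ⟨h, hh, k, hk, e⟩ := hm x
    obtain rfl : i = c := by omega
    rw [zero_add, pow_one, ← e]
    exact mul_mem_sup hh hk
  | succ j ih =>
    have hle := lowerCentralSeries_le_upperCentralSeries hc (i := i + 1) (j := j + 1) (by omega)
    have hcomm := commutator_upperCentralSeries_lowerCentralSeries_le (G := G) j i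
    rw [show i + j + 1 = c by omega] at hcomm
    set N := upperCentralSeries G i with hN
    have hS : lowerCentralSeries H (j + 1) ⊔ N =
        ((lowerCentralSeries H (j + 1)).map (QuotientGroup.mk' N)).comap (QuotientGroup.mk' N) := by
      rw [comap_map_eq, QuotientGroup.ker_mk']
    rw [hS, mem_comap, map_pow]
    rw [lowerCentralSeries_succ] at hx hle
    have hcen : ∀ y ∈ ⁅lowerCentralSeries (⊤ : Subgroup G) j, ⊤⁆,
        QuotientGroup.mk' N y ∈ center (G ⧸ N) := fun y hy => mk_mem_center_iff.2 (hle hy)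
    refine closure_induction (p := fun x _ => QuotientGroup.mk' N x ^ m ^ (j + 1 + 1) ∈ _)
      ?_ ?_ ?_ ?_ hx
    -- Modulo N, [p, q]^(m^(j+2)) = [p^(m^(j+1)), q^m] = [az, hk] = [a, h]: z is central modulo N,
    -- and [a, k] ∈ [γ_{j+1}(G), Z_c] ≤ N.
    · rintro _ ⟨p, hp, q, -, rfl⟩
      have hpq := hcen _ (commutator_mem_commutator hp (mem_top q))
      obtain ⟨h, hh, k, hk, e⟩ := hm q
      have h1 := ih (i := i + 1) (by omega) hp
      rw [mem_sup_of_normal_right] at h1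
      obtain ⟨a, ha, z, hz, e'⟩ := h1
      rw [map_commutatorElement] at hpq ⊢
      rw [pow_succ m, ← commutatorElement_pow_pow_of_mem_center hpq, ← map_pow, ← map_pow, ← e,
        ← e', map_mul, map_mul, commutatorElement_mul_mul_of_commute (z := QuotientGroup.mk' N z) (mk_mem_center_iff.2 hz),
        ← map_commutatorElement]
      · exact mem_map_of_mem _ (commutator_mem_commutator ha hh)
      · rw [← commutatorElement_eq_one_iff_commute, ← map_commutatorElement]
        exact (QuotientGroup.eq_one_iff _).2 (hcomm (commutator_mem_commutator
          (lowerCentralSeries_mono j le_top ha) hk))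
    · simp
    · intro x y hx hy h1 h2
      have : Commute (QuotientGroup.mk' N x) (QuotientGroup.mk' N y) :=
        (mem_center_iff.1 (hcen x hx) _).symm
      rw [map_mul, this.mul_pow]
      exact mul_mem h1 h2
    · intro x _ h1
      rw [map_inv, inv_pow]
      exact inv_mem h1

end Commutators

/-! ### Extraction of roots in torsion-free nilpotent groups -/

section TorsionFree

variable {G : Type*} [Group G]

theorem eq_one_of_pow_eq_one (tf : ∀ x : G, IsOfFinOrder x → x = 1) {x : G} {n : ℕ} (hn : 0 < n)
    (h : x ^ n = 1) : x = 1 :=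
  tf x (isOfFinOrder_iff_pow_eq_one.2 ⟨n, hn, h⟩)

theorem mem_upperCentralSeries_of_pow_mem_of_mem_succ (tf : ∀ x : G, IsOfFinOrder x → x = 1)
    {i n : ℕ} (hn : 0 < n) {x : G} (hx : x ∈ upperCentralSeries G (i + 1))
    (h : x ^ n ∈ upperCentralSeries G i) : x ∈ upperCentralSeries G i := by
  induction i generalizing x with
  | zero => exact mem_bot.2 (eq_one_of_pow_eq_one tf hn (mem_bot.1 h))
  | succ i ih =>
    intro y
    refine ih (hx y) ?_
    have := (commutatorElement_pow_pow_mem_iff (hx y) n 1).1 (h (y ^ 1))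
    rwa [mul_one] at this

theorem mem_upperCentralSeries_of_pow_mem [Group.IsNilpotent G]
    (tf : ∀ x : G, IsOfFinOrder x → x = 1) {i n : ℕ} (hn : 0 < n) {x : G}
    (h : x ^ n ∈ upperCentralSeries G i) : x ∈ upperCentralSeries G i := by
  have key : ∀ k, x ∈ upperCentralSeries G (i + k) → x ∈ upperCentralSeries G i := by
    intro k
    induction k with
    | zero => exact id
    | succ k ih =>
      exact fun hx => ih (mem_upperCentralSeries_of_pow_mem_of_mem_succ tf hn hx
        (upperCentralSeries_mono G (Nat.le_add_right i k) h))
  obtain ⟨c, hc⟩ := Group.IsNilpotent.nilpotent G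
  exact key c (upperCentralSeries_mono G (Nat.le_add_left c i) (hc.ge (mem_top x)))

/-- Descend the upper central series: once [x, y] lies in Z_{i+k+1}, the bracket is bimultiplicative
on powers of x and y modulo Z_{i+k}, so [x, y]^(nm) ∈ Z_{i+k}, and roots can be extracted. -/
theorem commutatorElement_mem_upperCentralSeries_of_pow [Group.IsNilpotent G]
    (tf : ∀ x : G, IsOfFinOrder x → x = 1) {i n m : ℕ} (hn : 0 < n) (hm : 0 < m) {x y : G}
    (h : ⁅x ^ n, y ^ m⁆ ∈ upperCentralSeries G i) : ⁅x, y⁆ ∈ upperCentralSeries G i := by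
  have key : ∀ k, ⁅x, y⁆ ∈ upperCentralSeries G (i + k) → ⁅x, y⁆ ∈ upperCentralSeries G i := by
    intro k
    induction k with
    | zero => exact id
    | succ k ih =>
      exact fun hx => ih (mem_upperCentralSeries_of_pow_mem tf (Nat.mul_pos hn hm)
        ((commutatorElement_pow_pow_mem_iff hx n m).1
          (upperCentralSeries_mono G (Nat.le_add_right i k) h)))
  obtain ⟨c, hc⟩ := Group.IsNilpotent.nilpotent G
  exact key c (upperCentralSeries_mono G (Nat.le_add_left c i) (hc.ge (mem_top _)))

theorem commute_of_commute_pow_pow [Group.IsNilpotent G]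
    (tf : ∀ x : G, IsOfFinOrder x → x = 1) {n m : ℕ} (hn : 0 < n) (hm : 0 < m) {x y : G}
    (h : Commute (x ^ n) (y ^ m)) : Commute x y :=
  commutatorElement_eq_one_iff_commute.1 (mem_bot.1
    (commutatorElement_mem_upperCentralSeries_of_pow (i := 0) tf hn hm (mem_bot.2 h.commutator_eq)))

theorem mem_center_of_pow_mem [Group.IsNilpotent G] (tf : ∀ x : G, IsOfFinOrder x → x = 1)
    {n : ℕ} (hn : 0 < n) {x : G} (h : x ^ n ∈ center G) : x ∈ center G := by
  rw [← upperCentralSeries_one] at *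
  exact mem_upperCentralSeries_of_pow_mem tf hn h

end TorsionFree

end Subgroup

/-! ### Finite generation and rank of subgroups (index 0 means infinite index) -/

namespace Subgroup

/-- Every subgroup is finitely generated, and there is a natural-valued monotone rank function on
subgroups that is strictly monotone along inclusions of infinite index. -/
structure IsNoetherianRanked (G : Type*) [Group G] : Prop where
  subgroup_fg : ∀ K : Subgroup G, K.FG
  exists_rank : ∃ d : Subgroup G → ℕ, Monotone d ∧
    ∀ K' K : Subgroup G, K' ≤ K → K'.relIndex K = 0 → d K' < d K

variable {G : Type*} [Group G]

theorem FG.of_inf_of_map (K N : Subgroup G) [N.Normal] (h1 : (K ⊓ N).FG)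
    (h2 : (K.map (QuotientGroup.mk' N)).FG) : K.FG := by
  classical
  obtain ⟨S, hS⟩ := h2
  have hex : ∀ s : S, ∃ k ∈ K, QuotientGroup.mk' N k = s := fun s => by
    have : (s : G ⧸ N) ∈ K.map (QuotientGroup.mk' N) := hS ▸ subset_closure s.2
    exact this
  choose t ht hts using hex
  have hT : (closure (Set.range t)).FG :=
    (Group.fg_iff_subgroup_fg _).1 (Group.closure_finite_fg (Set.range t))
  have hle : closure (Set.range t) ≤ K := (closure_le K).2 (Set.range_subset_iff.2 ht)
  have hmap : K.map (QuotientGroup.mk' N) ≤ (closure (Set.range t)).map (QuotientGroup.mk' N) := by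
    rw [← hS, closure_le]
    exact fun s hs => ⟨t ⟨s, hs⟩, subset_closure ⟨_, rfl⟩, hts ⟨s, hs⟩⟩
  have : K = closure (Set.range t) ⊔ K ⊓ N := by
    refine le_antisymm (fun k hk => ?_) (sup_le hle inf_le_left)
    obtain ⟨a, ha, hak⟩ := hmap (mem_map_of_mem _ hk)
    have h3 : a⁻¹ * k ∈ N := QuotientGroup.eq.1 hak
    rw [← mul_inv_cancel_left a k]
    exact mul_mem_sup ha ⟨K.mul_mem (K.inv_mem (hle ha)) hk, h3⟩
  rw [this]
  exact hT.sup h1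

theorem relIndex_eq_of_forall_exists_mul {A B K : Subgroup G} (hBA : B ≤ A)
    (h : ∀ a ∈ A, ∃ b ∈ B, ∃ k ∈ K, b * k = a) : K.relIndex A = K.relIndex B := by
  refine (Nat.card_congr (Equiv.ofBijective (quotientSubgroupOfEmbeddingOfLE K hBA)
    ⟨(quotientSubgroupOfEmbeddingOfLE K hBA).injective, fun x => ?_⟩)).symm
  obtain ⟨⟨x, hx⟩, rfl⟩ := QuotientGroup.mk_surjective x
  obtain ⟨b, hb, k, hk, rfl⟩ := h x hx
  refine ⟨QuotientGroup.mk ⟨b, hb⟩, ?_⟩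
  rw [quotientSubgroupOfEmbeddingOfLE_apply_mk, QuotientGroup.eq]
  simpa [mem_subgroupOf] using hk

theorem relIndex_ne_zero_of_inf_of_map {K' K N : Subgroup G} [N.Normal] (hle : K' ≤ K)
    (h1 : K'.relIndex (K ⊓ N) ≠ 0)
    (h2 : (K'.map (QuotientGroup.mk' N)).relIndex (K.map (QuotientGroup.mk' N)) ≠ 0) :
    K'.relIndex K ≠ 0 := by
  rw [relIndex_map_map, QuotientGroup.ker_mk'] at h2
  have h3 : (K' ⊔ N).relIndex K ≠ 0 := fun h => h2 (relIndex_eq_zero_of_le_right le_sup_left h)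
  rw [sup_comm, ← inf_relIndex_right] at h3
  refine relIndex_ne_zero_trans ?_ h3
  rwa [relIndex_eq_of_forall_exists_mul (B := K ⊓ N)
    (le_inf (inf_le_right.trans le_sup_left) inf_le_left)]
  rintro x ⟨hx, hxK⟩
  obtain ⟨n, hn, k, hk, rfl⟩ := mem_sup_of_normal_left.1 hx
  exact ⟨n, ⟨(mul_mem_cancel_right (hle hk)).1 hxK, hn⟩, k, hk, rfl⟩

namespace IsNoetherianRanked

theorem of_normal {G : Type*} [Group G] (N : Subgroup G) [N.Normal] (h1 : IsNoetherianRanked N)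
    (h2 : IsNoetherianRanked (G ⧸ N)) : IsNoetherianRanked G := by
  constructor
  · intro K
    refine FG.of_inf_of_map K N ?_ (h2.1 _)
    rw [← subgroupOf_map_subtype]
    have := (Group.fg_iff_subgroup_fg _).2 (h1.1 (K.subgroupOf N))
    rw [← range_subtype (K.subgroupOf N), MonoidHom.map_range]
    exact (Group.fg_iff_subgroup_fg _).1 inferInstance
  · obtain ⟨d₁, hm₁, hd₁⟩ := h1.2
    obtain ⟨d₂, hm₂, hd₂⟩ := h2.2
    -- Rank is additive along the extension: an inclusion of infinite index has infinite index on N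
    -- or on the quotient.
    refine ⟨fun K => d₁ (K.subgroupOf N) + d₂ (K.map (QuotientGroup.mk' N)),
      fun K' K h => add_le_add (hm₁ (comap_mono h)) (hm₂ (map_mono h)), fun K' K h h0 => ?_⟩
    have l1 := hm₁ (comap_mono h : K'.subgroupOf N ≤ K.subgroupOf N)
    have l2 := hm₂ (map_mono h : K'.map (QuotientGroup.mk' N) ≤ K.map (QuotientGroup.mk' N))
    by_cases h3 : (K'.subgroupOf N).relIndex (K.subgroupOf N) = 0
    · exact add_lt_add_of_lt_of_le (hd₁ _ _ (comap_mono h) h3) l2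
    · refine add_lt_add_of_le_of_lt l1 (hd₂ _ _ (map_mono h) ?_)
      by_contra h4
      refine relIndex_ne_zero_of_inf_of_map h ?_ h4 h0
      rwa [subgroupOf, relIndex_comap, subgroupOf_map_subtype] at h3

theorem of_commute {A : Type*} [Group A] [Group.FG A] (h : ∀ a b : A, a * b = b * a) :
    IsNoetherianRanked A := by
  let _ : CommGroup A := { (inferInstance : Group A) with mul_comm := h }
  have : Module.Finite ℤ (Additive A) := Module.Finite.iff_addGroup_fg.2 inferInstance
  let e : Subgroup A → Submodule ℤ (Additive A) := fun K =>
    AddSubgroup.toIntSubmodule (Subgroup.toAddSubgroup K)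
  have emono : Monotone e := fun K' K h => h
  constructor
  · intro K
    rw [Subgroup.fg_iff_add_fg]
    exact (Submodule.fg_iff_addSubgroup_fg (e K)).1 (IsNoetherian.noetherian (e K))
  · refine ⟨fun K => Module.finrank ℤ (e K),
      fun K' K h => Submodule.finrank_mono (emono h), fun K' K h h0 => ?_⟩
    have hsum := Submodule.finrank_quotient_add_finrank ((e K').comap (e K).subtype)
    have h1 : Module.finrank ℤ ((e K').comap (e K).subtype) = Module.finrank ℤ (e K') :=
      (Submodule.comapSubtypeEquivOfLe (emono h)).finrank_eq
    by_contra hlt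
    have h2 : Module.finrank ℤ (e K ⧸ (e K').comap (e K).subtype) = 0 := by
      change ¬ (Module.finrank ℤ (e K') < Module.finrank ℤ (e K)) at hlt
      omega
    have h3 : Finite (e K ⧸ (e K').comap (e K).subtype) :=
      Module.finite_of_fg_torsion _ (Module.finrank_eq_zero_iff_isTorsion.1 h2)
    rw [← relIndex_toAddSubgroup] at h0
    exact (AddSubgroup.index_ne_zero_iff_finite.2 h3) h0

theorem of_lowerCentralSeries_eq_bot (n : ℕ) : ∀ (G : Type*) [Group G] [Group.FG G],
    lowerCentralSeries (⊤ : Subgroup G) n = ⊥ → IsNoetherianRanked G := by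
  induction n with
  | zero =>
    intro G _ _ h
    have : Subsingleton G := Subgroup.subsingleton_iff.1 (subsingleton_of_bot_eq_top h.symm)
    exact of_commute fun a b => Subsingleton.elim _ _
  | succ n ih =>
    intro G _ _ h
    set N := lowerCentralSeries (⊤ : Subgroup G) n with hN
    have hcen : N ≤ center G := commutator_top_right_eq_bot_iff_le_center.1 h
    have hQ : IsNoetherianRanked (G ⧸ N) := by
      refine ih _ ?_
      rw [← map_top_of_surjective (QuotientGroup.mk' N) (QuotientGroup.mk'_surjective N),
        ← map_lowerCentralSeries, Subgroup.map_eq_bot_iff, QuotientGroup.ker_mk']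
    have hfg : N.FG := by
      cases n with
      | zero => exact Group.fg_def.1 inferInstance
      | succ j =>
        obtain ⟨S, hS, hSfin⟩ := Group.fg_iff.1 ‹Group.FG G›
        obtain ⟨R, hR⟩ := hQ.1 ((lowerCentralSeries (⊤ : Subgroup G) j).map (QuotientGroup.mk' N))
        have hNj : N ≤ lowerCentralSeries ⊤ j := lowerCentralSeries_antitone ⊤ (Nat.le_succ j)
        -- N is generated by the commutators of finitely many lifts of generators of γ_{j+1}/N with
        -- generators of G: these generate a central C, modulo which the lifts and N are central,
        -- hence so is γ_{j+1}.
        let T : Set G := Quotient.out '' (R : Set (G ⧸ N))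
        have hT : T ⊆ lowerCentralSeries (⊤ : Subgroup G) j := by
          rintro _ ⟨r, hr, rfl⟩
          have h1 : r ∈ (lowerCentralSeries (⊤ : Subgroup G) j).map (QuotientGroup.mk' N) :=
            hR ▸ subset_closure hr
          obtain ⟨x, hx, hxr⟩ := h1
          have h2 : x⁻¹ * r.out ∈ N :=
            QuotientGroup.eq.1 (hxr.trans (QuotientGroup.out_eq' r).symm)
          simpa using mul_mem hx (hNj h2)
        let C : Subgroup G := closure (Set.image2 (fun t s => ⁅t, s⁆) T S)
        have hCN : C ≤ N := by
          refine (closure_le _).2 ?_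
          rintro _ ⟨t, ht, s, -, rfl⟩
          exact commutator_mem_commutator (hT ht) (mem_top s)
        have hCnorm : C.Normal := ⟨fun x hx g => by
          rwa [mem_center_iff.1 (hcen (hCN hx)) g, mul_inv_cancel_right]⟩
        have hNC : N ≤ C := by
          have hNU : N ≤ upperCentralSeriesStep C := fun x hx y => by
            rw [(show Commute x y from (mem_center_iff.1 (hcen hx) y).symm).commutator_eq]
            exact one_mem C
          have hTU : T ⊆ upperCentralSeriesStep C := by
            intro t ht y
            have h1 : closure S ≤
                (centralizer {QuotientGroup.mk' C t}).comap (QuotientGroup.mk' C) := by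
              refine (closure_le _).2 fun s hs => ?_
              refine mem_centralizer_singleton_iff.2 ?_
              have h2 : (QuotientGroup.mk' C) ⁅t, s⁆ = 1 :=
                (QuotientGroup.eq_one_iff _).2 (subset_closure ⟨t, ht, s, hs, rfl⟩)
              rw [map_commutatorElement, commutatorElement_eq_one_iff_mul_comm] at h2
              exact h2.symm
            rw [hS] at h1
            have h2 := mem_centralizer_singleton_iff.1 (h1 (mem_top y))
            refine (QuotientGroup.eq_one_iff _).1 ?_
            exact commutatorElement_eq_one_iff_mul_comm.2 h2.symm
          have hle : lowerCentralSeries (⊤ : Subgroup G) j ≤ upperCentralSeriesStep C := by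
            intro x hx
            have h1 : (lowerCentralSeries (⊤ : Subgroup G) j).map (QuotientGroup.mk' N) ≤
                (upperCentralSeriesStep C).map (QuotientGroup.mk' N) := by
              rw [← hR, closure_le]
              exact fun r hr => ⟨r.out, hTU ⟨r, hr, rfl⟩, QuotientGroup.out_eq' r⟩
            obtain ⟨u, hu, hux⟩ := h1 (mem_map_of_mem _ hx)
            simpa using mul_mem hu (hNU (QuotientGroup.eq.1 hux))
          exact commutator_le.2 fun a ha b _ => hle ha b
        have hfin : (Set.image2 (fun t s => ⁅t, s⁆) T S).Finite :=
          ((R.finite_toSet).image _).image2 _ hSfin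
        have : Finite (Set.image2 (fun t s => ⁅t, s⁆) T S) := hfin
        rw [le_antisymm hNC hCN]
        exact (Group.fg_iff_subgroup_fg _).1 (Group.closure_finite_fg _)
    have : Group.FG N := (Group.fg_iff_subgroup_fg N).2 hfg
    exact of_normal N (of_commute fun a b => Subtype.ext (mem_center_iff.1 (hcen b.2) a)) hQ

theorem of_isNilpotent (G : Type*) [Group G] [Group.FG G] [Group.IsNilpotent G] :
    IsNoetherianRanked G :=
  of_lowerCentralSeries_eq_bot _ G lowerCentralSeries_nilpotencyClass

/-- If f(H) had infinite index, iterating K ↦ f(K ∩ H) from G would make the rank drop forever: f is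
injective and H has finite index, so each step inherits infinite index from the previous one. -/
theorem index_range_ne_zero {G : Type*} [Group G] (hG : IsNoetherianRanked G) {H : Subgroup G}
    (hH : H.index ≠ 0) {f : H →* G} (hf : Function.Injective f) : f.range.index ≠ 0 := by
  intro h0
  obtain ⟨d, -, hd⟩ := hG.2
  let U : ℕ → Subgroup G := fun n => Nat.rec ⊤ (fun _ K => (K.subgroupOf H).map f) n
  have hU : ∀ n, U (n + 1) = ((U n).subgroupOf H).map f := fun n => rfl
  have key : ∀ n, U (n + 1) ≤ U n ∧ (U (n + 1)).relIndex (U n) = 0 := by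
    intro n
    induction n with
    | zero =>
      refine ⟨le_top, ?_⟩
      change ((⊤ : Subgroup H).map f).relIndex ⊤ = 0
      rwa [relIndex_top_right, ← MonoidHom.range_eq_map]
    | succ n ih =>
      refine ⟨map_mono (comap_mono ih.1), ?_⟩
      rw [hU (n + 1), hU n, ← hU n, relIndex_map_map_of_injective _ _ hf, subgroupOf,
        relIndex_comap, subgroupOf_map_subtype, inf_comm]
      by_contra h1
      have h2 : H.relIndex (U n) ≠ 0 := fun h => hH (index_eq_zero_of_relIndex_eq_zero h)
      have h3 := mul_ne_zero h1 h2
      rw [relIndex_inf_mul_relIndex] at h3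
      exact h3 (relIndex_eq_zero_of_le_left inf_le_left ih.2)
  have hlt : ∀ n, d (U n) + n ≤ d (U 0) := by
    intro n
    induction n with
    | zero => rfl
    | succ n ih =>
      have := hd _ _ (key n).1 (key n).2
      omega
  have := hlt (d (U 0) + 1)
  omega

end IsNoetherianRanked

end Subgroup

/-! ### Invariant subgroups of abelian groups -/

/-- Since B = X + J, φ induces an endomorphism ψ of B/J, a root of a monic integral polynomial. The
integrality lets a finite φ-orbit close up inside mB ≤ X. The inclusion in the conclusion says at
once that N ≤ X and φ(N) ≤ N. -/
theorem Submodule.exists_invariant_of_sup_eq_top {B : Type*} [AddCommGroup B] [Module.Finite ℤ B]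
    [Module.IsTorsionFree ℤ B] (X J : Submodule ℤ B) (φ : X →ₗ[ℤ] B) {m : ℕ} (hm : 0 < m)
    (hmX : ∀ b : B, (m : ℤ) • b ∈ X) (hsup : X ⊔ J = ⊤) (hJ : ∀ x : X, (x : B) ∈ J → φ x ∈ J)
    (hne : ∃ b : B, ∀ n : ℤ, n ≠ 0 → n • b ∉ J) :
    ∃ N : Submodule ℤ B, N ≠ ⊥ ∧ N ≤ (N.comap φ).map X.subtype := by
  have hm0 : (m : ℤ) ≠ 0 := by exact_mod_cast hm.ne'
  have hρ : Function.Surjective (J.mkQ ∘ₗ X.subtype) := by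
    intro y
    obtain ⟨b, rfl⟩ := J.mkQ_surjective y
    obtain ⟨x, hx, j, hj, rfl⟩ := Submodule.mem_sup.1 (hsup.ge (Submodule.mem_top : b ∈ ⊤))
    refine ⟨⟨x, hx⟩, ?_⟩
    simpa [eq_comm (a := (0 : B ⧸ J))] using hj
  obtain ⟨ψ, hψ⟩ : ∃ ψ : Module.End ℤ (B ⧸ J), ∀ x : X, ψ (J.mkQ x) = J.mkQ (φ x) := by
    refine ⟨(LinearMap.ker (J.mkQ ∘ₗ X.subtype)).liftQ (J.mkQ ∘ₗ φ) (fun x hx => ?_) ∘ₗ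
      ((J.mkQ ∘ₗ X.subtype).quotKerEquivOfSurjective hρ).symm.toLinearMap, fun x => ?_⟩
    · simpa using hJ x (by simpa using hx)
    · have : ((J.mkQ ∘ₗ X.subtype).quotKerEquivOfSurjective hρ).symm (J.mkQ x) =
          Submodule.Quotient.mk x := by
        rw [LinearEquiv.symm_apply_eq]
        rfl
      simp only [LinearMap.comp_apply, LinearEquiv.coe_coe, this]
      rfl
  -- φ is defined only on X; precomposing with m makes it an endomorphism of B, inducing mψ on B/J.
  let e : Module.End ℤ B := φ ∘ₗ LinearMap.codRestrict X ((m : ℤ) • LinearMap.id) hmX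
  have he : ∀ b, ∀ hb : (m : ℤ) • b ∈ X, φ ⟨(m : ℤ) • b, hb⟩ = e b := fun b hb => rfl
  have hπe : ∀ i : ℕ, ∀ b, J.mkQ ((e ^ i) b) = (m : ℤ) ^ i • (ψ ^ i) (J.mkQ b) := by
    intro i b
    induction i with
    | zero => simp
    | succ i ih =>
      rw [pow_succ', Module.End.mul_apply, ← he _ (hmX _), ← hψ, map_smul, ih, map_smul, map_smul,
        smul_smul, pow_succ', pow_succ', Module.End.mul_apply]
  obtain ⟨g, hg, hg0⟩ := Algebra.IsIntegral.isIntegral (R := ℤ) ψ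
  rw [← Polynomial.aeval_def, Polynomial.aeval_eq_sum_range] at hg0
  set d := g.natDegree with hd
  -- Homogenizing g makes P act on B/J as m^d g(ψ) = 0, so P maps B into J, which has smaller rank;
  -- hence P has a kernel.
  let P : Module.End ℤ B :=
    ∑ i ∈ Finset.range (d + 1), (g.coeff i * (m : ℤ) ^ (d - i)) • e ^ i
  have hPJ : ∀ b, P b ∈ J := by
    intro b
    rw [← J.ker_mkQ, LinearMap.mem_ker, LinearMap.sum_apply, map_sum]
    calc _ = ∑ i ∈ Finset.range (d + 1), (m : ℤ) ^ d • (g.coeff i • ψ ^ i) (J.mkQ b) := by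
          refine Finset.sum_congr rfl fun i hi => ?_
          have hi' : d - i + i = d := Nat.sub_add_cancel (Nat.lt_succ_iff.1 (Finset.mem_range.1 hi))
          rw [LinearMap.smul_apply, map_smul, hπe, LinearMap.smul_apply, smul_smul, smul_smul,
            mul_assoc, ← pow_add, hi', mul_comm]
      _ = 0 := by
          rw [← Finset.smul_sum, ← LinearMap.sum_apply, hg0, LinearMap.zero_apply, smul_zero]
  have hPinj : ¬ Function.Injective P := by
    intro hinj
    have h1 := LinearMap.finrank_le_finrank_of_injective
      (f := LinearMap.codRestrict J P hPJ) (fun a b h => hinj (congrArg Subtype.val h))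
    have h2 := J.finrank_quotient_add_finrank
    have h3 : Module.finrank ℤ (B ⧸ J) = 0 := by omega
    obtain ⟨b, hb⟩ := hne
    obtain ⟨⟨a, ha⟩, hab⟩ := (Module.finrank_eq_zero_iff_isTorsion.1 h3) (x := J.mkQ b)
    refine hb a (nonZeroDivisors.ne_zero ha) ?_
    rw [← J.ker_mkQ, LinearMap.mem_ker, map_smul]
    exact hab
  obtain ⟨v, hv, hv0⟩ : ∃ v, P v = 0 ∧ v ≠ 0 := by
    by_contra! h
    exact hPinj ((injective_iff_map_eq_zero P).2 h)
  -- For i < d, w i is a multiple of m, hence in X, and φ(w i) = w (i + 1); P v = 0 with g monic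
  -- puts w d back in the span of the earlier ones.
  let w : ℕ → B := fun i => (m : ℤ) ^ (d - i) • (e ^ i) v
  have hPw : ∑ i ∈ Finset.range (d + 1), g.coeff i • w i = 0 := by
    rw [← hv, LinearMap.sum_apply]
    exact Finset.sum_congr rfl fun i _ => by rw [LinearMap.smul_apply, smul_smul]
  have hlead : g.coeff d = 1 := hg
  rw [Finset.sum_range_succ, hlead, one_smul] at hPw
  have hd0 : 0 < d := by
    by_contra h
    have h0 : d = 0 := by omega
    simp only [h0, Finset.range_zero, Finset.sum_empty, zero_add] at hPw
    exact hv0 (by simpa [w, h0] using hPw)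
  refine ⟨Submodule.span ℤ (w '' Set.Iio d), ?_, ?_⟩
  · intro h
    have h1 : w 0 ∈ (⊥ : Submodule ℤ B) := h ▸ Submodule.subset_span ⟨0, hd0, rfl⟩
    exact smul_ne_zero (pow_ne_zero _ hm0) hv0 (by simpa [w] using h1)
  · have hN : ∀ i < d, w i ∈ Submodule.span ℤ (w '' Set.Iio d) :=
      fun i hi => Submodule.subset_span ⟨i, hi, rfl⟩
    rw [Submodule.span_le]
    rintro _ ⟨i, hi, rfl⟩
    have hi : i < d := hi
    have hwi : w i = (m : ℤ) • ((m : ℤ) ^ (d - (i + 1)) • (e ^ i) v) := by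
      rw [smul_smul, ← pow_succ', show d - (i + 1) + 1 = d - i by omega]
    refine ⟨⟨w i, hwi ▸ hmX _⟩, ?_, rfl⟩
    have hφ : φ ⟨w i, hwi ▸ hmX _⟩ = w (i + 1) := by
      simp only [hwi, he, map_smul]
      rw [← Module.End.mul_apply, ← pow_succ']
    rw [SetLike.mem_coe, Submodule.mem_comap, hφ]
    rcases Nat.lt_or_ge (i + 1) d with h | h
    · exact hN _ h
    · rw [show i + 1 = d by omega, eq_neg_of_add_eq_zero_right hPw]
      exact neg_mem (sum_mem fun j hj => Submodule.smul_mem _ _ (hN j (Finset.mem_range.1 hj)))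

namespace Subgroup

variable {G : Type*} [Group G]

/-- H need not be normal, but each g has a power in H with exponent at most the index; the factorial
is a common multiple. -/
theorem exists_pos_forall_pow_mem {H : Subgroup G} (hH : H.index ≠ 0) :
    ∃ m : ℕ, 0 < m ∧ ∀ g : G, g ^ m ∈ H :=
  ⟨H.index.factorial, Nat.factorial_pos _, fun g => pow_mem_of_index_ne_zero_of_dvd hH g
    fun _ h0 h => Nat.dvd_factorial h0 h⟩

theorem exists_invariant_of_mul_eq (tf : ∀ x : G, IsOfFinOrder x → x = 1) {H : Subgroup G}
    (hH : H.index ≠ 0) (f : H →* G) {B J : Subgroup G} (hcomm : ∀ a ∈ B, ∀ b ∈ B, a * b = b * a)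
    (hfg : B.FG) (hJB : J ≤ B) (hfB : ∀ x : H, (x : G) ∈ B → f x ∈ B)
    (hfJ : ∀ x : H, (x : G) ∈ J → f x ∈ J)
    (hmul : ∀ b ∈ B, ∃ x ∈ B, x ∈ H ∧ ∃ j ∈ J, x * j = b)
    (hne : ∃ b ∈ B, ∀ n : ℕ, 0 < n → b ^ n ∉ J) :
    ∃ N : Subgroup G, N ≤ B ∧ N ≤ H ∧ N ≠ ⊥ ∧ ∀ x : H, (x : G) ∈ N → f x ∈ N := by
  let _ : CommGroup B :=
    { (inferInstance : Group B) with mul_comm := fun a b => Subtype.ext (hcomm a a.2 b b.2) }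
  have : Group.FG B := (Group.fg_iff_subgroup_fg B).2 hfg
  have : Module.Finite ℤ (Additive B) := Module.Finite.iff_addGroup_fg.2 inferInstance
  have : IsMulTorsionFree B := IsMulTorsionFree.of_not_isOfFinOrder fun x hx hfin =>
    hx (Subtype.ext (tf x (Submonoid.isOfFinOrder_coe.2 hfin)))
  obtain ⟨m, hm, hmH⟩ := exists_pos_forall_pow_mem hH
  let e : Subgroup B → Submodule ℤ (Additive B) := fun K =>
    AddSubgroup.toIntSubmodule (Subgroup.toAddSubgroup K)
  let φ₀ : H.subgroupOf B →* B :=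
    { toFun := fun x => ⟨f ⟨x.1.1, x.2⟩, hfB ⟨x.1.1, x.2⟩ x.1.2⟩
      map_one' := Subtype.ext (map_one f)
      map_mul' := fun x y => Subtype.ext (map_mul f ⟨x.1.1, x.2⟩ ⟨y.1.1, y.2⟩) }
  let φ : e (H.subgroupOf B) →ₗ[ℤ] Additive B := (MonoidHom.toAdditive φ₀).toIntLinearMap
  obtain ⟨N, hN0, hN⟩ := Submodule.exists_invariant_of_sup_eq_top (e (H.subgroupOf B))
    (e (J.subgroupOf B)) φ hm
    (fun b => by
      rw [natCast_zsmul]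
      exact hmH (b.toMul : G))
    (eq_top_iff.2 fun b _ => by
      obtain ⟨x, hx, hxH, j, hj, hxj⟩ := hmul b.toMul b.toMul.2
      exact Submodule.mem_sup.2 ⟨Additive.ofMul ⟨x, hx⟩, hxH, Additive.ofMul ⟨j, hJB hj⟩, hj,
        Subtype.ext hxj⟩)
    (fun x hx => hfJ ⟨x.1.toMul, x.2⟩ hx)
    (by
      obtain ⟨b, hb, h⟩ := hne
      refine ⟨Additive.ofMul ⟨b, hb⟩, fun n hn hmem => ?_⟩
      have h1 : b ^ n ∈ J := hmem
      obtain ⟨k, rfl | rfl⟩ := n.eq_nat_or_neg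
      · exact h k (by omega) (by simpa using h1)
      · exact h k (by omega) (by simpa using h1))
  let K : Subgroup B := AddSubgroup.toSubgroup' N.toAddSubgroup
  have hK : ∀ x : B, x ∈ K → ∃ hx : (x : G) ∈ H, f ⟨x, hx⟩ ∈ K.map B.subtype := by
    intro x hx
    obtain ⟨y, hy, hyx⟩ := hN (show Additive.ofMul x ∈ N from hx)
    have hxy : (y.1.toMul : B) = x := hyx
    subst hxy
    exact ⟨y.2, φ y, hy, rfl⟩
  refine ⟨K.map B.subtype, map_subtype_le K, ?_, ?_, ?_⟩
  · rintro _ ⟨x, hx, rfl⟩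
    exact (hK x hx).1
  · intro h
    rw [Subgroup.map_eq_bot_iff_of_injective _ B.subtype_injective] at h
    refine hN0 ((Submodule.eq_bot_iff N).2 fun x hx => ?_)
    exact (eq_bot_iff_forall K).1 h x.toMul hx
  · rintro ⟨_, hxH⟩ ⟨x, hx, rfl⟩
    exact (hK x hx).2

end Subgroup

/-! ### Free abelian groups and subgroups of prime index -/

theorem IsFreeAbelian.of_fg {A : Type*} [Group A] [Group.FG A] (hcomm : ∀ a b : A, a * b = b * a)
    (tf : ∀ x : A, IsOfFinOrder x → x = 1) : IsFreeAbelian A := by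
  let _ : CommGroup A := { (inferInstance : Group A) with mul_comm := hcomm }
  have : Module.Finite ℤ (Additive A) := Module.Finite.iff_addGroup_fg.2 inferInstance
  have : IsMulTorsionFree A := IsMulTorsionFree.of_not_isOfFinOrder fun x hx hfin =>
    hx (tf x hfin)
  have : Module.Free ℤ (Additive A) := Module.free_of_finite_type_torsion_free'
  let b := Module.Free.chooseBasis ℤ (Additive A)
  let S : Set A := Set.range fun i => (b i).toMul
  have e : Module.Free.ChooseBasisIndex ℤ (Additive A) ≃ S :=
    Equiv.ofInjective _ (Additive.toMul.injective.comp b.injective)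
  exact ⟨S, ⟨AddEquiv.toMultiplicativeRight ((b.reindex e).repr.toAddEquiv.trans
    (FreeAbelianGroup.equivFinsupp S).symm)⟩⟩

namespace Subgroup

variable {G : Type*} [Group G]

theorem le_of_relIndex_prime {X A Z : Subgroup G} (h : (X.relIndex Z).Prime) (hXA : X ≤ A)
    (hAZ : A ≤ Z) (hA : ¬ A ≤ X) : Z ≤ A := by
  have h1 := relIndex_mul_relIndex X A Z hXA hAZ
  rw [← relIndex_eq_one]
  refine ((Nat.dvd_prime h).1 ⟨X.relIndex A, by rw [← h1, mul_comm]⟩).resolve_right fun h2 => ?_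
  rw [h2] at h1
  exact hA (relIndex_eq_one.1 (Nat.eq_of_mul_eq_mul_right h.pos (by rw [h1, one_mul])))

theorem sup_eq_top_of_index_prime {X A : Subgroup G} (h : X.index.Prime) (hA : ¬ A ≤ X) :
    X ⊔ A = ⊤ := by
  rw [← relIndex_top_right] at h
  exact top_le_iff.1 (le_of_relIndex_prime h le_sup_left le_top fun h' => hA (le_sup_right.trans h'))

theorem mem_upperCentralSeries_succ_of_index_ne_zero [Group.IsNilpotent G]
    (tf : ∀ x : G, IsOfFinOrder x → x = 1) {K : Subgroup G} (hK : K.index ≠ 0) {i : ℕ} {x : G}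
    (h : ∀ k ∈ K, ⁅x, k⁆ ∈ Subgroup.upperCentralSeries G i) : x ∈ Subgroup.upperCentralSeries G (i + 1) := by
  intro y
  obtain ⟨m, hm, hmK⟩ := exists_pos_forall_pow_mem hK
  refine commutatorElement_mem_upperCentralSeries_of_pow tf one_pos hm ?_
  rw [pow_one]
  exact h _ (hmK y)

theorem normal_of_le_center {K : Subgroup G} (hK : K ≤ center G) : K.Normal :=
  ⟨fun x hx g => by rwa [mem_center_iff.1 (hK hx) g, mul_inv_cancel_right]⟩

end Subgroup

/-! ### Simple virtual endomorphisms -/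

namespace VirtualEndo

open Subgroup (center mem_center_iff)

variable {G : Type*} [Group G] {H : Subgroup G} {f : H →* G}

theorem IsSimple.eq_bot (hf : IsSimple f) {K : Subgroup G} (hKH : K ≤ H) (hK : K.Normal)
    (hKf : ∀ x : H, (x : G) ∈ K → f x ∈ K) : K = ⊥ := by
  rw [← le_bot_iff, ← hf]
  exact le_sSup ⟨hKH, hK, hKf⟩

theorem IsSimple.eq_bot_of_le_map_comap (hf : IsSimple f) {K : Subgroup G} (hK : K.Normal)
    (h : K ≤ (K.comap f).map H.subtype) : K = ⊥ := by
  refine hf.eq_bot (h.trans (Subgroup.map_subtype_le _)) hK fun x hx => ?_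
  obtain ⟨y, hy, hyx⟩ := h hx
  obtain rfl : y = x := Subtype.ext hyx
  exact hy

theorem map_mem_lowerCentralSeries (f : H →* G) {j : ℕ} {x : H}
    (hx : (x : G) ∈ H.lowerCentralSeries j) : f x ∈ (⊤ : Subgroup G).lowerCentralSeries j := by
  rw [← Subgroup.top_subtype_lowerCentralSeries] at hx
  obtain ⟨y, hy, hyx⟩ := hx
  obtain rfl : y = x := Subtype.ext hyx
  have := Subgroup.mem_map_of_mem f hy
  rw [Subgroup.map_lowerCentralSeries] at this
  exact Subgroup.lowerCentralSeries_mono j le_top this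

theorem IsSimple.lowerCentralSeries_eq_bot (hf : IsSimple f) {j : ℕ}
    (h : (⊤ : Subgroup G).lowerCentralSeries j ≤ H.lowerCentralSeries j) :
    (⊤ : Subgroup G).lowerCentralSeries j = ⊥ :=
  hf.eq_bot (h.trans (H.lowerCentralSeries_le_self j)) inferInstance
    fun _ hx => map_mem_lowerCentralSeries f (h hx)

theorem IsSimple.mul_comm_of_sup_center_eq_top (hf : IsSimple f) (h : H ⊔ center G = ⊤) (a b : G) :
    a * b = b * a := by
  have h1 := hf.lowerCentralSeries_eq_bot (j := 1) (Subgroup.commutator_le.2 fun a _ b _ => by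
    obtain ⟨x, hx, z, hz, rfl⟩ := Subgroup.mem_sup_of_normal_right.1 (h.ge (Subgroup.mem_top a))
    obtain ⟨y, hy, w, hw, rfl⟩ := Subgroup.mem_sup_of_normal_right.1 (h.ge (Subgroup.mem_top b))
    rw [Subgroup.commutatorElement_mul_mul_of_commute hz (mem_center_iff.1 hw x)]
    exact Subgroup.commutator_mem_commutator hx hy)
  refine commutatorElement_eq_one_iff_mul_comm.1 (Subgroup.mem_bot.1 (h1 ▸ ?_))
  exact Subgroup.commutator_mem_commutator (Subgroup.mem_top a) (Subgroup.mem_top b)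

/-- The kernel meets Z(G) trivially by simplicity. Climbing the upper central series, a kernel
element commutes with H, hence is central, hence trivial. -/
theorem IsSimple.injective [Group.IsNilpotent G] (tf : ∀ x : G, IsOfFinOrder x → x = 1)
    (hH : H.index ≠ 0) (hf : IsSimple f) : Function.Injective f := by
  have hbot : f.ker.map H.subtype ⊓ center G = ⊥ := by
    refine hf.eq_bot (inf_le_left.trans (Subgroup.map_subtype_le _))
      (Subgroup.normal_of_le_center inf_le_right) fun x hx => ?_
    obtain ⟨y, hy, hyx⟩ := hx.1
    obtain rfl : y = x := Subtype.ext hyx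
    rw [MonoidHom.mem_ker.1 hy]
    exact one_mem _
  have key : ∀ i, ∀ x : H, (x : G) ∈ Subgroup.upperCentralSeries G i → f x = 1 → x = 1 := by
    intro i
    induction i with
    | zero => exact fun x hx _ => Subtype.ext (Subgroup.mem_bot.1 hx)
    | succ i ih =>
      intro x hx hfx
      have h1 : (x : G) ∈ center G := by
        rw [← Subgroup.upperCentralSeries_one]
        refine Subgroup.mem_upperCentralSeries_succ_of_index_ne_zero tf hH fun k hk => ?_
        have := ih ⁅x, ⟨k, hk⟩⁆ (hx k) (by
          rw [map_commutatorElement, hfx, commutatorElement_one_left])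
        exact congrArg Subtype.val this
      exact Subtype.ext (Subgroup.mem_bot.1 (hbot ▸ ⟨⟨x, hfx, rfl⟩, h1⟩))
  obtain ⟨c, hc⟩ := Group.IsNilpotent.nilpotent G
  exact (injective_iff_map_eq_one f).2 fun x => key c x (hc.ge (Subgroup.mem_top _))

theorem IsSimple.map_mem_upperCentralSeries [Group.FG G] [Group.IsNilpotent G]
    (tf : ∀ x : G, IsOfFinOrder x → x = 1) (hH : H.index ≠ 0) (hf : IsSimple f) (i : ℕ) (x : H)
    (hx : (x : G) ∈ Subgroup.upperCentralSeries G i) : f x ∈ Subgroup.upperCentralSeries G i := by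
  induction i generalizing x with
  | zero =>
    obtain rfl : x = 1 := Subtype.ext (Subgroup.mem_bot.1 hx)
    rw [map_one]
    exact one_mem _
  | succ i ih =>
    refine Subgroup.mem_upperCentralSeries_succ_of_index_ne_zero tf
      ((Subgroup.IsNoetherianRanked.of_isNilpotent G).index_range_ne_zero hH
        (hf.injective tf hH)) ?_
    rintro _ ⟨h, rfl⟩
    rw [← map_commutatorElement]
    exact ih _ (hx h)

theorem IsSimple.map_mem_center [Group.FG G] [Group.IsNilpotent G]
    (tf : ∀ x : G, IsOfFinOrder x → x = 1) (hH : H.index ≠ 0) (hf : IsSimple f) (x : H)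
    (hx : (x : G) ∈ center G) : f x ∈ center G := by
  rw [← Subgroup.upperCentralSeries_one] at *
  exact hf.map_mem_upperCentralSeries tf hH 1 x hx

theorem IsSimple.not_center_le [Nontrivial G] [Group.FG G] [Group.IsNilpotent G]
    (tf : ∀ x : G, IsOfFinOrder x → x = 1) (hH : H.index ≠ 0) (hf : IsSimple f) :
    ¬ center G ≤ H := fun h =>
  Group.IsNilpotent.center_ne_bot G (hf.eq_bot h inferInstance (hf.map_mem_center tf hH))

theorem IsSimple.mul_comm_of_index_prime [Group.FG G] [Group.IsNilpotent G]
    (tf : ∀ x : G, IsOfFinOrder x → x = 1) (hH : H.index.Prime) (hf : IsSimple f) (a b : G) :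
    a * b = b * a := by
  cases subsingleton_or_nontrivial G
  · exact Subsingleton.elim _ _
  · exact hf.mul_comm_of_sup_center_eq_top
      (Subgroup.sup_eq_top_of_index_prime hH (hf.not_center_le tf hH.ne_zero)) a b

/-! ### The preimage of the induced core -/

section InducedCore

variable {N : Subgroup G} [N.Normal] (hN : ∀ x : H, (x : G) ∈ N → f x ∈ N)

theorem le_inducedCore : N ≤ inducedCore f N hN := by
  intro x hx
  change QuotientGroup.mk' N x ∈ core _
  rw [show QuotientGroup.mk' N x = 1 from (QuotientGroup.eq_one_iff x).2 hx]
  exact one_mem _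

theorem inducedCore_le : inducedCore f N hN ≤ H ⊔ N := by
  have h := Subgroup.comap_mono (f := QuotientGroup.mk' N) (core_isGreatest (induced f N hN)).1.1
  rwa [Subgroup.comap_map_eq, QuotientGroup.ker_mk'] at h

theorem map_mem_inducedCore (x : H) (hx : (x : G) ∈ inducedCore f N hN) :
    f x ∈ inducedCore f N hN := by
  have h := (core_isGreatest (induced f N hN)).1.2.2
    ⟨QuotientGroup.mk' N x, Subgroup.mem_map_of_mem _ x.2⟩ hx
  rwa [induced_apply] at h

theorem le_inducedCore_of_invariant {K : Subgroup G} [K.Normal] (hNK : N ≤ K) (hKH : K ≤ H ⊔ N)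
    (hKf : ∀ x : H, (x : G) ∈ K → f x ∈ K) : K ≤ inducedCore f N hN := by
  refine Subgroup.map_le_iff_le_comap.1 (le_sSup ⟨?_, ?_, ?_⟩)
  · rw [Subgroup.map_le_iff_le_comap, Subgroup.comap_map_eq, QuotientGroup.ker_mk']
    exact hKH
  · exact Subgroup.Normal.map inferInstance _ (QuotientGroup.mk'_surjective N)
  · rintro ⟨_, h, hh, rfl⟩ hx
    have h1 : h ∈ (K.map (QuotientGroup.mk' N)).comap (QuotientGroup.mk' N) := hx
    rw [Subgroup.comap_map_eq, QuotientGroup.ker_mk', sup_eq_left.2 hNK] at h1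
    have h2 := induced_apply f N hN ⟨h, hh⟩
    simp only at h2
    rw [h2]
    exact Subgroup.mem_map_of_mem _ (hKf ⟨h, hh⟩ h1)

end InducedCore

end VirtualEndo

theorem Nat.prime_and_prime_of_mul_eq_mul {a b p q : ℕ} (hp : p.Prime) (hq : q.Prime)
    (h : a * b = p * q) (ha : a ≠ 1) (hb : b ≠ 1) : a.Prime ∧ b.Prime := by
  wlog hpa : p ∣ a generalizing a b
  · have hpb : p ∣ b := (hp.dvd_mul.1 ⟨q, h⟩).resolve_left hpa
    exact (this (by rw [mul_comm, h]) hb ha hpb).symm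
  obtain ⟨k, rfl⟩ := hpa
  have hkb : k * b = q := Nat.eq_of_mul_eq_mul_left hp.pos (by rw [← mul_assoc, h])
  obtain rfl | rfl := (Nat.dvd_prime hq).1 ⟨b, hkb.symm⟩
  · rw [one_mul] at hkb
    exact ⟨by rwa [mul_one], hkb ▸ hq⟩
  · exact absurd (Nat.eq_of_mul_eq_mul_left hq.pos (by rw [hkb, mul_one])) hb

/-! ### The two prime indices and the four claims -/

namespace VirtualEndo

open Subgroup (center mem_center_iff)

variable {G : Type*} [Group G] {H : Subgroup G} {f : H →* G}

theorem relIndex_center_mul_index_sup (H : Subgroup G) :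
    H.relIndex (center G) * (H ⊔ center G).index = H.index := by
  rw [← Subgroup.relIndex_mul_index (le_sup_left : H ≤ H ⊔ center G),
    Subgroup.relIndex_eq_of_forall_exists_mul (le_sup_right : center G ≤ H ⊔ center G)]
  intro x hx
  obtain ⟨h, hh, z, hz, rfl⟩ := Subgroup.mem_sup_of_normal_right.1 hx
  exact ⟨z, hz, h, hh, (mem_center_iff.1 hz h).symm⟩

theorem IsSimple.prime_relIndex_center_and_prime_index_sup [Group.FG G] [Group.IsNilpotent G]
    (tf : ∀ x : G, IsOfFinOrder x → x = 1) {p q : ℕ} (hp : p.Prime) (hq : q.Prime)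
    (hH : H.index = p * q) (hf : IsSimple f) (hG : ∃ a b : G, a * b ≠ b * a) :
    (H.relIndex (center G)).Prime ∧ (H ⊔ center G).index.Prime := by
  have hH0 : H.index ≠ 0 := hH ▸ mul_ne_zero hp.ne_zero hq.ne_zero
  obtain ⟨a, b, hab⟩ := hG
  refine Nat.prime_and_prime_of_mul_eq_mul hp hq
    ((relIndex_center_mul_index_sup H).trans hH) (fun h => ?_) (fun h => ?_)
  · have : Nontrivial G := ⟨⟨_, _, hab⟩⟩
    exact hf.not_center_le tf hH0 (Subgroup.relIndex_eq_one.1 h)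
  · exact hab (hf.mul_comm_of_sup_center_eq_top (Subgroup.index_eq_one.1 h) a b)

/-- A normal `f`-invariant subgroup of `HZ(G)` containing `Z(G)` is abelian. -/
theorem IsSimple.mul_comm_of_le_sup_center (hf : IsSimple f) {L : Subgroup G} [L.Normal]
    (hZL : center G ≤ L) (hL : L ≤ H ⊔ center G) (hLf : ∀ x : H, (x : G) ∈ L → f x ∈ L) :
    ∀ a ∈ L, ∀ b ∈ L, a * b = b * a := by
  have hdec : ∀ a ∈ L, ∃ h : H, (h : G) ∈ L ∧ ∃ z ∈ center G, h * z = a := by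
    intro a ha
    obtain ⟨h, hh, z, hz, rfl⟩ := Subgroup.mem_sup_of_normal_right.1 (hL ha)
    exact ⟨⟨h, hh⟩, (mul_mem_cancel_right (hZL hz)).1 ha, z, hz, rfl⟩
  have h1 : ⁅L, L⁆ = ⊥ := by
    refine hf.eq_bot_of_le_map_comap inferInstance (Subgroup.commutator_le.2 ?_)
    intro a ha b hb
    obtain ⟨x, hx, z, hz, rfl⟩ := hdec a ha
    obtain ⟨y, hy, w, hw, rfl⟩ := hdec b hb
    rw [Subgroup.commutatorElement_mul_mul_of_commute hz (mem_center_iff.1 hw x)]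
    refine ⟨⁅x, y⁆, ?_, map_commutatorElement _ x y⟩
    rw [SetLike.mem_coe, Subgroup.mem_comap, map_commutatorElement]
    exact Subgroup.commutator_mem_commutator (hLf x hx) (hLf y hy)
  intro a ha b hb
  exact commutatorElement_eq_one_iff_mul_comm.1
    (Subgroup.mem_bot.1 (h1 ▸ Subgroup.commutator_mem_commutator ha hb))

/-- If `G = HI` with `I` abelian and normal, the normal closure of an `f`-invariant subgroup of
`I ∩ H` is contained in the core. -/
theorem IsSimple.eq_bot_of_sup_eq_top (hf : IsSimple f) {I N : Subgroup G} [I.Normal]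
    (hI : ∀ a ∈ I, ∀ b ∈ I, a * b = b * a) (hIH : H ⊔ I = ⊤) (hNI : N ≤ I) (hNH : N ≤ H)
    (hNf : ∀ x : H, (x : G) ∈ N → f x ∈ N) : N = ⊥ := by
  have h1 : Subgroup.normalClosure (N : Set G) = ⊥ := by
    refine hf.eq_bot_of_le_map_comap inferInstance ((Subgroup.closure_le _).2 fun y hy => ?_)
    obtain ⟨a, ha, hay⟩ := Group.mem_conjugatesOfSet_iff.1 hy
    obtain ⟨g, rfl⟩ := isConj_iff.1 hay
    obtain ⟨h, hh, i, hi, rfl⟩ :=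
      Subgroup.mem_sup_of_normal_right.1 (hIH.ge (Subgroup.mem_top g))
    -- I is abelian, so only conjugation by H matters, and f respects it.
    have h2 : h * i * a * (h * i)⁻¹ = h * a * h⁻¹ := by
      rw [mul_assoc h i a, hI i hi a (hNI ha)]
      group
    refine ⟨⟨h, hh⟩ * ⟨a, hNH ha⟩ * ⟨h, hh⟩⁻¹, ?_, h2.symm⟩
    rw [SetLike.mem_coe, Subgroup.mem_comap, map_mul, map_mul, map_inv]
    exact Subgroup.normalClosure_normal.conj_mem _
      (Subgroup.subset_normalClosure (hNf ⟨a, hNH ha⟩ ha)) _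
  exact le_bot_iff.1 (h1 ▸ Subgroup.le_normalClosure)

/-- The quotient by a maximal normal `f`-invariant subgroup of `HZ(G)` containing `Z(G)` is
torsion-free, when `HZ(G)` has prime index. -/
theorem IsSimple.mem_of_pow_mem [Group.FG G] [Group.IsNilpotent G]
    (tf : ∀ x : G, IsOfFinOrder x → x = 1) (hH : H.index ≠ 0) (hf : IsSimple f)
    (hr : (H ⊔ center G).index.Prime) {L : Subgroup G} [L.Normal]
    (hZL : center G ≤ L) (hL : L ≤ H ⊔ center G) (hLf : ∀ x : H, (x : G) ∈ L → f x ∈ L)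
    (hmax : ∀ K : Subgroup G, K.Normal → center G ≤ K → K ≤ H ⊔ center G →
      (∀ x : H, (x : G) ∈ K → f x ∈ K) → K ≤ L)
    {n : ℕ} (hn : 0 < n) {x : G} (hx : x ^ n ∈ L) : x ∈ L := by
  have hcomm := hf.mul_comm_of_le_sup_center hZL hL hLf
  have hI : ∀ a b : G, ∀ n m : ℕ, 0 < n → 0 < m → a ^ n ∈ L → b ^ m ∈ L → Commute a b :=
    fun a b n m hn hm ha hb => Subgroup.commute_of_commute_pow_pow tf hn hm (hcomm _ ha _ hb)
  let I : Subgroup G :=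
    { carrier := isolator L
      one_mem' := ⟨1, one_pos, by rw [one_pow]; exact one_mem L⟩
      mul_mem' := by
        rintro a b ⟨n, hn, ha⟩ ⟨m, hm, hb⟩
        refine ⟨n * m, Nat.mul_pos hn hm, ?_⟩
        rw [(hI a b n m hn hm ha hb).mul_pow, pow_mul, mul_comm n, pow_mul]
        exact mul_mem (pow_mem ha m) (pow_mem hb n)
      inv_mem' := by
        rintro a ⟨n, hn, ha⟩
        exact ⟨n, hn, by rw [inv_pow]; exact inv_mem ha⟩ }
  have hLI : L ≤ I := fun a ha => ⟨1, one_pos, by rwa [pow_one]⟩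
  have hInorm : I.Normal := by
    constructor
    rintro a ⟨n, hn, ha⟩ g
    exact ⟨n, hn, by rw [conj_pow]; exact Subgroup.Normal.conj_mem inferInstance _ ha g⟩
  have hIf : ∀ x : H, (x : G) ∈ I → f x ∈ I := by
    rintro x ⟨n, hn, hx⟩
    exact ⟨n, hn, by rw [← map_pow]; exact hLf (x ^ n) hx⟩
  by_cases hIH : I ≤ H ⊔ center G
  · exact hmax I hInorm (hZL.trans hLI) hIH hIf ⟨n, hn, hx⟩
  exfalso
  have htop : H ⊔ I = ⊤ := by
    rw [← Subgroup.sup_eq_top_of_index_prime hr hIH, sup_assoc, sup_eq_right.2 (hZL.trans hLI)]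
  obtain ⟨N, hNL, hNH, hN, hNf⟩ := Subgroup.exists_invariant_of_mul_eq tf hH f hcomm
    ((Subgroup.IsNoetherianRanked.of_isNilpotent G).1 L) hZL hLf (hf.map_mem_center tf hH)
    (fun b hb => by
      obtain ⟨h, hh, z, hz, rfl⟩ := Subgroup.mem_sup_of_normal_right.1 (hL hb)
      exact ⟨h, (mul_mem_cancel_right (hZL hz)).1 hb, hh, z, hz, rfl⟩)
    -- If L/Z(G) were torsion, L and then I would lie in Z(G), against I not lying in HZ(G).
    (by
      by_contra! h
      have hLZ : ∀ b ∈ L, b ∈ center G := fun b hb => by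
        obtain ⟨k, hk, hbk⟩ := h b hb
        exact Subgroup.mem_center_of_pow_mem tf hk hbk
      refine hIH fun a ha => ?_
      obtain ⟨k, hk, hak⟩ := ha
      exact Subgroup.mem_sup_right (Subgroup.mem_center_of_pow_mem tf hk (hLZ _ hak)))
  refine hN (hf.eq_bot_of_sup_eq_top (I := I) ?_ htop (hNL.trans hLI) hNH hNf)
  rintro a ⟨n, hn, ha⟩ b ⟨m, hm, hb⟩
  exact hI a b n m hn hm ha hb

section Center

variable (hZ : ∀ x : H, (x : G) ∈ center G → f x ∈ center G)

/-- The core modulo L pulls back to a normal invariant subgroup of HL = HZ(G), which maximality of L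
absorbs. -/
theorem isSimple_induced_inducedCore :
    IsSimple (induced f (inducedCore f (center G) hZ) (map_mem_inducedCore hZ)) := by
  set L := inducedCore f (center G) hZ with hLdef
  have hLf : ∀ x : H, (x : G) ∈ L → f x ∈ L := map_mem_inducedCore hZ
  have hle : inducedCore f L hLf ≤ L :=
    le_inducedCore_of_invariant hZ ((le_inducedCore hZ).trans (le_inducedCore hLf))
      ((inducedCore_le hLf).trans (sup_le le_sup_left (inducedCore_le hZ)))
      (map_mem_inducedCore hLf)
  rw [IsSimple, eq_bot_iff]
  intro y hy
  obtain ⟨x, rfl⟩ := QuotientGroup.mk'_surjective L y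
  exact Subgroup.mem_bot.2 ((QuotientGroup.eq_one_iff x).2 (hle hy))

theorem index_map_mk_inducedCore :
    (H.map (QuotientGroup.mk' (inducedCore f (center G) hZ))).index = (H ⊔ center G).index := by
  rw [Subgroup.index_map, QuotientGroup.ker_mk', QuotientGroup.range_mk', Subgroup.index_top,
    mul_one]
  congr 1
  exact le_antisymm (sup_le le_sup_left (inducedCore_le hZ)) (sup_le_sup_left (le_inducedCore hZ) H)

variable [Group.FG G] [Group.IsNilpotent G]

theorem IsSimple.torsionFree_quotient (tf : ∀ x : G, IsOfFinOrder x → x = 1) (hH : H.index ≠ 0)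
    (hf : IsSimple f) (hr : (H ⊔ center G).index.Prime)
    (y : G ⧸ inducedCore f (center G) hZ) (hy : IsOfFinOrder y) : y = 1 := by
  obtain ⟨x, rfl⟩ := QuotientGroup.mk_surjective y
  obtain ⟨n, hn, hx⟩ := isOfFinOrder_iff_pow_eq_one.1 hy
  rw [← QuotientGroup.mk_pow, QuotientGroup.eq_one_iff] at hx
  rw [QuotientGroup.eq_one_iff]
  exact hf.mem_of_pow_mem tf hH hr (le_inducedCore hZ) (inducedCore_le hZ) (map_mem_inducedCore hZ)
    (fun K _ h1 h2 h3 => le_inducedCore_of_invariant hZ h1 h2 h3) hn hx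

theorem IsSimple.isFreeAbelian_inducedCore (tf : ∀ x : G, IsOfFinOrder x → x = 1)
    (hf : IsSimple f) : IsFreeAbelian (inducedCore f (center G) hZ) := by
  have : Group.FG (inducedCore f (center G) hZ) := (Group.fg_iff_subgroup_fg _).2
    ((Subgroup.IsNoetherianRanked.of_isNilpotent G).1 _)
  refine IsFreeAbelian.of_fg (fun a b => Subtype.ext ?_) fun x hx => Subtype.ext ?_
  · exact hf.mul_comm_of_le_sup_center (le_inducedCore hZ) (inducedCore_le hZ)
      (map_mem_inducedCore hZ) a a.2 b b.2
  · exact tf x (Submonoid.isOfFinOrder_coe.2 hx)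

theorem IsSimple.isFreeAbelian_quotient (tf : ∀ x : G, IsOfFinOrder x → x = 1) (hH : H.index ≠ 0)
    (hf : IsSimple f) (hr : (H ⊔ center G).index.Prime) :
    IsFreeAbelian (G ⧸ inducedCore f (center G) hZ) := by
  have htf := hf.torsionFree_quotient hZ tf hH hr
  refine IsFreeAbelian.of_fg (fun a b => ?_) htf
  refine (isSimple_induced_inducedCore hZ).mul_comm_of_index_prime htf ?_ a b
  rwa [index_map_mk_inducedCore]

theorem IsSimple.mul_range_eq_univ (tf : ∀ x : G, IsOfFinOrder x → x = 1) (hH : H.index ≠ 0)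
    (hf : IsSimple f) (hs : (H.relIndex (center G)).Prime) (hr : (H ⊔ center G).index.Prime) :
    (H : Set G) * (f.range : Set G) = Set.univ := by
  have hZ := hf.map_mem_center tf hH
  have : (H ⊔ center G).Normal := by
    refine Subgroup.NormalizerCondition.normal_of_coatom _
      Group.normalizerCondition_of_isNilpotent ⟨fun h => ?_, fun K hK => ?_⟩
    · rw [h, Subgroup.index_top] at hr
      exact Nat.not_prime_one hr
    · rw [← Subgroup.sup_eq_top_of_index_prime hr hK.not_ge, sup_eq_right.2 hK.le]
  -- Otherwise HZ(G), normal as a maximal subgroup of a nilpotent group, would be invariant, so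
  -- contained in L; then G/L is finite and torsion-free, forcing HZ(G) = G.
  have h1 : ¬ f.range ≤ H ⊔ center G := by
    intro h
    have h2 := le_inducedCore_of_invariant hZ le_sup_right le_rfl
      fun x _ => h (MonoidHom.mem_range.2 ⟨x, rfl⟩)
    have h3 : H ⊔ center G = ⊤ := by
      refine top_le_iff.1 fun x _ => ?_
      obtain ⟨n, hn, -, hx⟩ := Subgroup.exists_pow_mem_of_index_ne_zero hr.ne_zero x
      refine inducedCore_le hZ ((QuotientGroup.eq_one_iff x).1
        (hf.torsionFree_quotient hZ tf hH hr _ (isOfFinOrder_iff_pow_eq_one.2 ⟨n, hn, ?_⟩)))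
      exact (QuotientGroup.eq_one_iff _).2 (h2 hx)
    rw [h3, Subgroup.index_top] at hr
    exact Nat.not_prime_one hr
  have htop := Subgroup.sup_eq_top_of_index_prime hr h1
  set W := H ⊓ center G with hW
  have hWnorm : W.Normal := Subgroup.normal_of_le_center inf_le_right
  set V := (W.subgroupOf H).map f with hV
  have hVZ : V ≤ center G := by
    rintro _ ⟨x, hx, rfl⟩
    exact hZ x hx.2
  have hVW : ¬ V ≤ W := by
    intro h
    have h2 : W = ⊥ := hf.eq_bot inf_le_left hWnorm fun x hx => h ⟨x, hx, rfl⟩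
    refine hs.ne_one (Subgroup.relIndex_eq_one.2 fun x hx => ?_)
    obtain ⟨n, hn, -, hxn⟩ := Subgroup.exists_pow_mem_of_relIndex_ne_zero hs.ne_zero hx
    rw [← hW, h2, Subgroup.mem_bot] at hxn
    rw [Subgroup.eq_one_of_pow_eq_one tf hn hxn]
    exact one_mem H
  have hZWV : center G ≤ W ⊔ V := by
    refine Subgroup.le_of_relIndex_prime (X := W) ?_ le_sup_left (sup_le inf_le_right hVZ)
      fun h => hVW (le_sup_right.trans h)
    rwa [hW, Subgroup.inf_relIndex_right]
  refine Set.eq_univ_of_forall fun g => ?_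
  obtain ⟨m, hm, y, hy, hg⟩ :=
    Subgroup.mem_sup_of_normal_left.1 (htop.ge (Subgroup.mem_top g))
  obtain ⟨h, hh, z, hz, rfl⟩ := Subgroup.mem_sup_of_normal_right.1 hm
  obtain ⟨w, hw, v, hv, rfl⟩ := Subgroup.mem_sup_of_normal_left.1 (hZWV hz)
  obtain ⟨u, -, rfl⟩ := hv
  -- The central factor splits as w·f(u) with w ∈ H, so one part joins H and the other f(H).
  exact ⟨h * w, mul_mem hh hw.1, f u * y, mul_mem ⟨u, rfl⟩ hy, by rw [← hg]; group⟩

theorem IsSimple.upperCentralSeries_le_inducedCore (tf : ∀ x : G, IsOfFinOrder x → x = 1)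
    (hH : H.index ≠ 0) (hf : IsSimple f) (hr : (H ⊔ center G).index.Prime) {c : ℕ} (hc : 0 < c)
    (hclass : Group.nilpotencyClass G = c + 1) :
    Subgroup.upperCentralSeries G c ≤ inducedCore f (center G) hZ := by
  have hZc : center G ≤ Subgroup.upperCentralSeries G c := by
    rw [← Subgroup.upperCentralSeries_one]
    exact Subgroup.upperCentralSeries_mono G hc
  refine le_inducedCore_of_invariant hZ hZc ?_ (hf.map_mem_upperCentralSeries tf hH c)
  by_contra h
  have htop : H ⊔ Subgroup.upperCentralSeries G c = ⊤ := by
    rw [← Subgroup.sup_eq_top_of_index_prime hr h, sup_assoc, sup_eq_right.2 hZc]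
  have h1 : (⊤ : Subgroup G).lowerCentralSeries c ≤ H.lowerCentralSeries c := by
    intro x hx
    have h2 := Subgroup.pow_mem_lowerCentralSeries_sup (H := H) (m := 1) (i := 0)
      (Subgroup.upperCentralSeries_eq_top_iff_nilpotencyClass_le.2 hclass.le) (fun g => by
        obtain ⟨h, hh, k, hk, e⟩ :=
          Subgroup.mem_sup_of_normal_right.1 (htop.ge (Subgroup.mem_top g))
        exact ⟨h, hh, k, hk, by rw [e, pow_one]⟩) (zero_add c) hx
    rwa [one_pow, pow_one, Subgroup.upperCentralSeries_zero, sup_bot_eq] at h2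
  have h2 := Subgroup.lowerCentralSeries_eq_bot_iff_nilpotencyClass_le.1
    (hf.lowerCentralSeries_eq_bot h1)
  omega

theorem IsSimple.center_eq_isolator (tf : ∀ x : G, IsOfFinOrder x → x = 1)
    (hf : IsSimple f) (hs : (H.relIndex (center G)).Prime) (hH : H.index ≠ 0) {c : ℕ}
    (hclass : Group.nilpotencyClass G = c + 1) :
    (center G : Set G) = isolator ((⊤ : Subgroup G).lowerCentralSeries c) := by
  have hZ := hf.map_mem_center tf hH
  set γ := (⊤ : Subgroup G).lowerCentralSeries c with hγ
  have hγZ : γ ≤ center G := Subgroup.commutator_top_right_eq_bot_iff_le_center.1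
    (Subgroup.lowerCentralSeries_eq_bot_iff_nilpotencyClass_le.2 hclass.le)
  have hγ0 : γ ≠ ⊥ := fun h => by
    have := Subgroup.lowerCentralSeries_eq_bot_iff_nilpotencyClass_le.1 h
    omega
  have hsub : isolator γ ⊆ center G := fun x ⟨n, hn, hx⟩ =>
    Subgroup.mem_center_of_pow_mem tf hn (hγZ hx)
  let J : Subgroup G :=
    { carrier := isolator γ
      one_mem' := ⟨1, one_pos, by rw [one_pow]; exact one_mem γ⟩
      mul_mem' := by
        rintro a b ha hb
        have hab : Commute a b := mem_center_iff.1 (hsub hb) a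
        obtain ⟨n, hn, ha⟩ := ha
        obtain ⟨m, hm, hb⟩ := hb
        refine ⟨n * m, Nat.mul_pos hn hm, ?_⟩
        rw [hab.mul_pow, pow_mul, mul_comm n, pow_mul]
        exact mul_mem (pow_mem ha m) (pow_mem hb n)
      inv_mem' := by
        rintro a ⟨n, hn, ha⟩
        exact ⟨n, hn, by rw [inv_pow]; exact inv_mem ha⟩ }
  have hJZ : J ≤ center G := hsub
  have hJnorm : J.Normal := Subgroup.normal_of_le_center hJZ
  have hJf : ∀ x : H, (x : G) ∈ J → f x ∈ J := by
    rintro x ⟨n, hn, hx⟩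
    obtain ⟨m, hm, hmH⟩ := Subgroup.exists_pos_forall_pow_mem hH
    have h2 := Subgroup.pow_mem_lowerCentralSeries_sup (H := H) (m := m) (i := 0)
      (Subgroup.upperCentralSeries_eq_top_iff_nilpotencyClass_le.2 hclass.le)
      (fun g => ⟨g ^ m, hmH g, 1, one_mem _, mul_one _⟩) (zero_add c) hx
    rw [Subgroup.upperCentralSeries_zero, sup_bot_eq, ← pow_mul] at h2
    refine ⟨n * m ^ (c + 1), Nat.mul_pos hn (pow_pos hm _), ?_⟩
    rw [← map_pow]
    exact map_mem_lowerCentralSeries f h2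
  refine Set.Subset.antisymm (fun b hb => ?_) hsub
  by_contra hbJ
  have hγJ : γ ≤ J := fun x hx => ⟨1, one_pos, by rwa [pow_one]⟩
  have hJH : ¬ J ≤ H := fun h => hγ0 (le_bot_iff.1 (hγJ.trans (hf.eq_bot h hJnorm hJf).le))
  have hZJ : center G ≤ H ⊓ center G ⊔ J := by
    refine Subgroup.le_of_relIndex_prime (X := H ⊓ center G) ?_ le_sup_left
      (sup_le inf_le_right hJZ) fun h => hJH ((le_sup_right.trans h).trans inf_le_left)
    rwa [Subgroup.inf_relIndex_right]
  obtain ⟨N, hNZ, hNH, hN, hNf⟩ := Subgroup.exists_invariant_of_mul_eq tf hH f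
    (fun a _ b hb => mem_center_iff.1 hb a)
    ((Subgroup.IsNoetherianRanked.of_isNilpotent G).1 (center G)) hJZ hZ hJf
    (fun b hb => by
      obtain ⟨x, hx, j, hj, e⟩ := Subgroup.mem_sup_of_normal_right.1 (hZJ hb)
      exact ⟨x, hx.2, hx.1, j, hj, e⟩)
    (by
      refine ⟨b, hb, fun n hn h => hbJ ?_⟩
      obtain ⟨k, hk, h⟩ := h
      exact ⟨n * k, Nat.mul_pos hn hk, by rwa [pow_mul]⟩)
  exact hN (hf.eq_bot hNH (Subgroup.normal_of_le_center hNZ) hNf)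

end Center

end VirtualEndo

/-! ### The theorem -/

theorem mainTheorem8 {G : Type*} [Group G] [Group.FG G] [Group.IsNilpotent G]
    (torsionFree : ∀ x : G, IsOfFinOrder x → x = 1)
    (c : ℕ) (hc : Group.nilpotencyClass G = c)
    (p q : ℕ) (hp : p.Prime) (hq : q.Prime)
    (H : Subgroup G) (hH : H.index = p * q)
    (f : H →* G) (hf : VirtualEndo.IsSimple f) :
    -- the map induced by `f` on `HZ(G)/Z(G)` is well defined
    ∃ hZ : ∀ x : H, (x : G) ∈ Subgroup.center G → f x ∈ Subgroup.center G,
      (IsFreeAbelian (VirtualEndo.inducedCore f (Subgroup.center G) hZ) ∧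
        IsFreeAbelian (G ⧸ VirtualEndo.inducedCore f (Subgroup.center G) hZ)) ∧
      ((∃ a b : G, a * b ≠ b * a) → (H : Set G) * (f.range : Set G) = Set.univ) ∧
      Subgroup.upperCentralSeries G (c - 1) ≤
        VirtualEndo.inducedCore f (Subgroup.center G) hZ ∧
      (Subgroup.center G : Set G) =
        VirtualEndo.isolator (Subgroup.lowerCentralSeries (⊤ : Subgroup G) (c - 1)) := by
  have hH0 : H.index ≠ 0 := hH ▸ mul_ne_zero hp.ne_zero hq.ne_zero
  have hZ := hf.map_mem_center torsionFree hH0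
  refine ⟨hZ, ?_⟩
  by_cases hG : ∃ a b : G, a * b ≠ b * a
  · obtain ⟨hs, hr⟩ := hf.prime_relIndex_center_and_prime_index_sup torsionFree hp hq hH hG
    have hc2 : 1 < c := by
      by_contra! h
      obtain ⟨a, b, hab⟩ := hG
      exact hab ((Group.IsNilpotent.nilpotencyClass_le_one_iff.1 (hc.trans_le h)).1.1 a b)
    obtain ⟨c, rfl⟩ : ∃ k, c = k + 1 := ⟨c - 1, by omega⟩
    rw [Nat.add_sub_cancel]
    exact ⟨⟨hf.isFreeAbelian_inducedCore hZ torsionFree,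
      hf.isFreeAbelian_quotient hZ torsionFree hH0 hr⟩,
      fun _ => hf.mul_range_eq_univ torsionFree hH0 hs hr,
      hf.upperCentralSeries_le_inducedCore hZ torsionFree hH0 hr (by omega) hc,
      hf.center_eq_isolator torsionFree hs hH0 hc⟩
  · have hcen : Subgroup.center G = ⊤ := by
      push Not at hG
      exact top_le_iff.1 fun x _ => Subgroup.mem_center_iff.2 fun y => hG y x
    have hL : ∀ x, x ∈ VirtualEndo.inducedCore f (Subgroup.center G) hZ := fun x =>
      VirtualEndo.le_inducedCore hZ (hcen.ge (Subgroup.mem_top x))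
    have hsub : ∀ y : G ⧸ VirtualEndo.inducedCore f (Subgroup.center G) hZ, y = 1 := fun y => by
      obtain ⟨x, rfl⟩ := QuotientGroup.mk_surjective y
      exact (QuotientGroup.eq_one_iff x).2 (hL x)
    -- For abelian G truncated subtraction covers c = 0 as well as c = 1, and the series term is all
    -- of G.
    have hc1 : c - 1 = 0 := by
      have := Subgroup.upperCentralSeries_eq_top_iff_nilpotencyClass_le.1
        ((Subgroup.upperCentralSeries_one G).trans hcen)
      omega
    refine ⟨⟨hf.isFreeAbelian_inducedCore hZ torsionFree, IsFreeAbelian.of_fg (fun a b => ?_)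
      fun y _ => hsub y⟩, fun h => absurd h hG, fun x _ => hL x, ?_⟩
    · rw [hsub a, hsub b]
    · rw [hcen, hc1, Subgroup.lowerCentralSeries_zero]
      exact (Set.eq_univ_of_forall fun x => (⟨1, one_pos, Subgroup.mem_top _⟩ : ∃ n, _)).symm
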